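/- Let $U_1,\dots,U_m\subset\mathbb{R}^n$ be closed convex sets, let $U:=\bigcap_{i=1}^m U_i$, and let $P_C$ denote the Euclidean projection onto a nonempty closed convex set $C$. Given a starting point $x_1\in\mathbb{R}^n$, the Parallel Polyhedral Projection Method (3PM) generates the sequence $$x_{k+1}=P_{\Omega_k}(x_k),\qquad \Omega_k=\bigcap_{i=1}^m S_{ik},\qquad S_{ik}=\{z\in\mathbb{R}^n:\langle x_k-P_{U_i}(x_k),\,z-P_{U_i}(x_k)\rangle\le 0\},\qquad k\ge 1$$ (so that the sequence is constant once it reaches $U$). Theorem 2.3 (Superlinear convergence of 3PM). Assume that $\operatorname{int}(U)\neq\emptyset$ and that each boundary $\partial U_i$ is locally a differentiable manifold, i.e. around each of its points it is a $C^1$ embedded submanifold of $\mathbb{R}^n$. Then, for any starting point $x_1\in\mathbb{R}^n$, the sequence $(x_k)$ generated by 3PM converges to a point $\bar x\in U$. Let $I=\{i : \bar x\notin\operatorname{int}(U_i)\}$. If $x_k\notin\bigcup_{i\in I}U_i$ for all $k$ large enough, then $(x_k)$ converges to $\bar x$ superlinearly, that is, $\|x_{k+1}-\bar x\|=o(\|x_k-\bar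 x\|)$ as $k\to\infty$. -/

import Mathlib

open Filter Topology Asymptotics

/-- `p` is a point of `C` closest to `x`. -/
def IsProj {E : Type*} [NormedAddCommGroup E] [InnerProductSpace ℝ E]
    (C : Set E) (x p : E) : Prop :=
  p ∈ C ∧ ∀ y ∈ C, ‖x - p‖ ≤ ‖x - y‖

open Classical in
/-- The projection `P_C(x)`: the point of `C` closest to `x`.  By `isProj_proj` and `IsProj.eq_proj`
below it is the unique such point when `C` is nonempty, closed and convex; the value `x` is used if
there is no closest point. -/
noncomputable def proj {E : Type*} [NormedAddCommGroup E] [InnerProductSpace ℝ E]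
    (C : Set E) (x : E) : E :=
  if h : ∃ p, IsProj C x p then h.choose else x

theorem isProj_proj {E : Type*} [NormedAddCommGroup E] [InnerProductSpace ℝ E] [CompleteSpace E]
    {C : Set E} (hne : C.Nonempty) (hcl : IsClosed C) (hcv : Convex ℝ C) (x : E) :
    IsProj C x (proj C x) := by
  have h : ∃ p, IsProj C x p := by
    obtain ⟨p, hp, hmin⟩ := exists_norm_eq_iInf_of_complete_convex hne hcl.isComplete hcv x
    refine ⟨p, hp, fun y hy => ?_⟩
    rw [hmin]
    exact ciInf_le ⟨0, by rintro _ ⟨z, rfl⟩; exact norm_nonneg _⟩ (⟨y, hy⟩ : C)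
  unfold proj
  rw [dif_pos h]
  exact h.choose_spec

theorem IsProj.inner_le_zero {E : Type*} [NormedAddCommGroup E] [InnerProductSpace ℝ E]
    {C : Set E} (hcv : Convex ℝ C) {x p : E} (h : IsProj C x p) {y : E} (hy : y ∈ C) :
    inner ℝ (x - p) (y - p) ≤ 0 := by
  have : Nonempty C := ⟨⟨p, h.1⟩⟩
  refine (norm_eq_iInf_iff_real_inner_le_zero hcv h.1).1 ?_ y hy
  refine le_antisymm (le_ciInf fun w => h.2 w w.2) ?_
  exact ciInf_le ⟨0, by rintro _ ⟨z, rfl⟩; exact norm_nonneg _⟩ (⟨p, h.1⟩ : C)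

theorem IsProj.eq_proj {E : Type*} [NormedAddCommGroup E] [InnerProductSpace ℝ E] [CompleteSpace E]
    {C : Set E} (hcl : IsClosed C) (hcv : Convex ℝ C) {x p : E} (h : IsProj C x p) :
    p = proj C x := by
  have hq := isProj_proj ⟨p, h.1⟩ hcl hcv x
  have h1 := h.inner_le_zero hcv hq.1
  have h2 := hq.inner_le_zero hcv h.1
  set q := proj C x
  have h3 : inner ℝ (p - q) (p - q) = inner ℝ (x - p) (q - p) + inner ℝ (x - q) (p - q) := by
    simp only [inner_sub_left, inner_sub_right, real_inner_comm]
    ring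
  have h4 : inner ℝ (p - q) (p - q) ≤ 0 := by rw [h3]; linarith
  exact sub_eq_zero.1 (inner_self_eq_zero.1 (le_antisymm h4 real_inner_self_nonneg))

/-- The half-space `{z | ⟪x - P_C(x), z - P_C(x)⟫ ≤ 0}` supporting `C` at `P_C(x)`
(the whole space if `x ∈ C`). -/
def supportHalfSpace {E : Type*} [NormedAddCommGroup E] [InnerProductSpace ℝ E]
    (C : Set E) (x : E) : Set E :=
  {z | inner ℝ (x - proj C x) (z - proj C x) ≤ 0}

/-- The polyhedron `Ω`: the intersection of the half-spaces built from `x` and the sets `U i`. -/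
def threePMPolyhedron {E : Type*} [NormedAddCommGroup E] [InnerProductSpace ℝ E]
    {ι : Type*} (U : ι → Set E) (x : E) : Set E :=
  ⋂ i, supportHalfSpace (U i) x

/-- The iterates of the Parallel Polyhedral Projection Method for the sets `U i`, started at `x₁`
(which is the iterate with index `0` here).  Once an iterate lies in `⋂ i, U i`, all half-spaces are
the whole space and the sequence is constant; this is the stopping rule of the method. -/
noncomputable def threePM {E : Type*} [NormedAddCommGroup E] [InnerProductSpace ℝ E]
    {ι : Type*} (U : ι → Set E) (x₁ : E) : ℕ → E
  | 0 => x₁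
  | k + 1 => proj (threePMPolyhedron U (threePM U x₁ k)) (threePM U x₁ k)

/-- `M` is locally a differentiable (`C¹`, embedded) manifold: around each of its points there is a
`C¹` diffeomorphism `φ` between open subsets of the ambient space that straightens `M` to a linear
subspace `L`.  The dimension of `L` is not prescribed. -/
def IsLocallyC1Manifold {E : Type*} [NormedAddCommGroup E] [NormedSpace ℝ E] (M : Set E) : Prop :=
  ∀ z ∈ M, ∃ (φ : OpenPartialHomeomorph E E) (L : Submodule ℝ E),
    z ∈ φ.source ∧ ContDiffOn ℝ 1 φ φ.source ∧ ContDiffOn ℝ 1 φ.symm φ.target ∧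
      ∀ y ∈ φ.source, y ∈ M ↔ φ y ∈ L

/-- `x k` converges to `a` superlinearly: `x k → a` and `‖x (k+1) - a‖ = o(‖x k - a‖)`, i.e.
the quotients `‖x (k+1) - a‖ / ‖x k - a‖` tend to `0`, with a sequence that
reaches `a` and stays there also counted. -/
def ConvergesSuperlinearly {E : Type*} [NormedAddCommGroup E] (x : ℕ → E) (a : E) : Prop :=
  Tendsto x atTop (𝓝 a) ∧ (fun k => x (k + 1) - a) =o[atTop] (fun k => x k - a)

/-! Convergence is Fejér monotonicity: `⋂ i, U i` lies in every polyhedron, so distances to its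
points decrease, steps tend to `0`, and steps dominate the distances to each `U i`
(`exists_tendsto_threePM`).

For the rate, let `a` be the limit. Convexity, interior points and a `C¹` boundary leave one outer
unit normal at `a` for each active set (`unit_normal_unique`), so the normals used by the method
converge (`exists_tendsto_unitNormal`). Hence `y = x_{k+1} - a` has inner product at most `o(‖x_k -
a‖)` with all later normals. Adding a small multiple of a vector `v` pointing from `a` to an
interior point makes these products nonpositive, so the sum is a recession direction of every later
polyhedron. No later step has a positive component against it; summing the steps up to the limit
bounds `‖y‖` (`norm_threePM_sub_le`). -/

open scoped RealInnerProductSpace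

/-! ### Projections, supporting half-spaces and unit normals. -/

section Projection

variable {E : Type*} [NormedAddCommGroup E] [InnerProductSpace ℝ E]

theorem isClosed_supportHalfSpace (C : Set E) (x : E) : IsClosed (supportHalfSpace C x) :=
  isClosed_le (by fun_prop) continuous_const

theorem convex_supportHalfSpace (C : Set E) (x : E) : Convex ℝ (supportHalfSpace C x) := by
  intro y hy z hz a b ha hb hab
  simp only [supportHalfSpace, Set.mem_ofPred_eq] at *
  have : a • y + b • z - proj C x = a • (y - proj C x) + b • (z - proj C x) := by
    obtain rfl : b = 1 - a := by linarith
    module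
  rw [this, inner_add_right, inner_smul_right, inner_smul_right]
  nlinarith

theorem norm_sub_le_of_inner_nonpos {x p a : E} (h : ⟪x - p, a - p⟫ ≤ 0) :
    ‖p - a‖ ≤ ‖x - a‖ ∧ ‖x - p‖ ≤ ‖x - a‖ := by
  have h1 : ‖x - a‖ ^ 2 = ‖x - p‖ ^ 2 - 2 * ⟪x - p, a - p⟫ + ‖p - a‖ ^ 2 := by
    rw [show x - a = (x - p) - (a - p) by abel, norm_sub_sq_real, norm_sub_rev a p]
  constructor <;> apply le_of_sq_le_sq _ (norm_nonneg _) <;>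
    nlinarith [sq_nonneg ‖x - p‖, sq_nonneg ‖p - a‖]

/-- The unit vector pointing from `P_C(x)` to `x` (zero if `x = P_C(x)`). -/
noncomputable def unitNormal (C : Set E) (x : E) : E := ‖x - proj C x‖⁻¹ • (x - proj C x)

theorem norm_smul_unitNormal (C : Set E) (x : E) :
    ‖x - proj C x‖ • unitNormal C x = x - proj C x := by
  rcases eq_or_ne (x - proj C x) 0 with h | h
  · simp [h]
  · rw [unitNormal, smul_inv_smul₀ (norm_ne_zero_iff.2 h)]

theorem inner_unitNormal_nonpos {C : Set E} {x z : E} (hz : z ∈ supportHalfSpace C x) :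
    ⟪unitNormal C x, z - proj C x⟫ ≤ 0 := by
  rw [unitNormal, real_inner_smul_left]
  exact mul_nonpos_of_nonneg_of_nonpos (by positivity) hz

theorem add_mem_supportHalfSpace {C : Set E} {x z t : E} (hz : z ∈ supportHalfSpace C x)
    (ht : ⟪unitNormal C x, t⟫ ≤ 0) : z + t ∈ supportHalfSpace C x := by
  have h : ⟪x - proj C x, t⟫ ≤ 0 := by
    rw [← norm_smul_unitNormal, real_inner_smul_left]
    exact mul_nonpos_of_nonneg_of_nonpos (norm_nonneg _) ht
  simp only [supportHalfSpace, Set.mem_ofPred_eq] at hz ⊢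
  rw [add_sub_right_comm, inner_add_right]
  linarith

variable [CompleteSpace E] {C : Set E}

theorem subset_supportHalfSpace (hcl : IsClosed C) (hcv : Convex ℝ C) (x : E) :
    C ⊆ supportHalfSpace C x := fun _ hy =>
  (isProj_proj ⟨_, hy⟩ hcl hcv x).inner_le_zero hcv hy

theorem proj_eq_self (hcl : IsClosed C) (hcv : Convex ℝ C) {x : E} (hx : x ∈ C) :
    proj C x = x :=
  (IsProj.eq_proj hcl hcv ⟨hx, fun y _ => by simp⟩).symm

theorem norm_proj_sub_le (hcl : IsClosed C) (hcv : Convex ℝ C) (x : E) {a : E} (ha : a ∈ C) :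
    ‖proj C x - a‖ ≤ ‖x - a‖ :=
  (norm_sub_le_of_inner_nonpos (subset_supportHalfSpace hcl hcv x ha)).1

theorem tendsto_proj {ι : Type*} {l : Filter ι} (hcl : IsClosed C) (hcv : Convex ℝ C) {x : ι → E}
    {a : E} (ha : a ∈ C) (hx : Tendsto x l (𝓝 a)) : Tendsto (fun k => proj C (x k)) l (𝓝 a) := by
  rw [tendsto_iff_norm_sub_tendsto_zero] at hx ⊢
  exact squeeze_zero (fun _ => norm_nonneg _) (fun k => norm_proj_sub_le hcl hcv (x k) ha) hx

theorem norm_unitNormal (hne : C.Nonempty) (hcl : IsClosed C) (hcv : Convex ℝ C) {x : E}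
    (hx : x ∉ C) : ‖unitNormal C x‖ = 1 := by
  have h : x - proj C x ≠ 0 := fun h =>
    hx (sub_eq_zero.1 h ▸ (isProj_proj hne hcl hcv x).1)
  rw [unitNormal, norm_smul, norm_inv, norm_norm, inv_mul_cancel₀ (norm_ne_zero_iff.2 h)]

end Projection

/-! ### Uniqueness and continuity of normals at a smooth boundary. -/

section SmoothBoundary

/-- Otherwise `interior t` and the complement of `closure t` would separate `s`. -/
theorem inter_frontier_nonempty {X : Type*} [TopologicalSpace X] {s t : Set X}
    (hs : IsPreconnected s) (h1 : (s ∩ t).Nonempty) (h2 : (s ∩ tᶜ).Nonempty) :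
    (s ∩ frontier t).Nonempty := by
  by_contra hf
  have hmem : ∀ x ∈ s, x ∈ closure t → x ∈ interior t := fun x hx hc => by
    by_contra hi
    exact hf ⟨x, hx, hc, hi⟩
  obtain ⟨x, hx, hxt⟩ := h1
  obtain ⟨y, hy, hyt⟩ := h2
  obtain ⟨z, -, hz1, hz2⟩ := hs (interior t) (closure t)ᶜ isOpen_interior
    isClosed_closure.isOpen_compl
    (fun z hz => (em (z ∈ closure t)).imp (hmem z hz) id)
    ⟨x, hx, hmem x hx (subset_closure hxt)⟩
    ⟨y, hy, fun hc => hyt (interior_subset (hmem y hy hc))⟩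
  exact hz2 (subset_closure (interior_subset hz1))

variable {E : Type*} [NormedAddCommGroup E] [InnerProductSpace ℝ E]

theorem inner_le_neg_of_closedBall_subset {C : Set E} {w a ν : E} {r : ℝ} (hr : 0 ≤ r)
    (hw : Metric.closedBall w r ⊆ C) (hν : ‖ν‖ = 1) (h : ∀ u ∈ C, ⟪ν, u - a⟫ ≤ 0) :
    ⟪ν, w - a⟫ ≤ -r := by
  have := h (w + r • ν) (hw (by simp [norm_smul, hν, abs_of_nonneg hr]))
  rw [add_sub_right_comm, inner_add_right, inner_smul_right, real_inner_self_eq_norm_sq, hν] at this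
  linarith

/-- Near a boundary point `a`, every direction `d` can be corrected along the inward direction
`w - a` to meet the boundary. -/
theorem exists_mem_frontier_add_smul {C : Set E} (hcv : Convex ℝ C) {a w ν d : E} {r K t : ℝ}
    (hr : 0 < r) (ha : a ∈ C) (hw : Metric.closedBall w r ⊆ C) (hν : ‖ν‖ = 1)
    (h : ∀ u ∈ C, ⟪ν, u - a⟫ ≤ 0) (hK : ‖d‖ < K * r) (ht : 0 < t) (htK : t * K ≤ 1) :
    ∃ s ∈ Set.Icc (-K) K, a + t • (d + s • (w - a)) ∈ frontier C := by
  have hK0 : 0 < K := pos_of_mul_pos_left ((norm_nonneg d).trans_lt hK) hr.le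
  have hpre : IsPreconnected ((fun s : ℝ => a + t • (d + s • (w - a))) '' Set.Icc (-K) K) :=
    isPreconnected_Icc.image _ (by fun_prop)
  -- A convex combination of `a` and `w + K⁻¹ • d`, with weight `t * K` on the latter.
  have hin : a + t • (d + K • (w - a)) ∈ C := by
    have h1 : w + K⁻¹ • d ∈ C := hw (by
      rw [mem_closedBall_iff_norm, add_sub_cancel_left, norm_smul, norm_inv, Real.norm_eq_abs,
        abs_of_pos hK0, inv_mul_le_iff₀ hK0]
      exact hK.le)
    have h2 := hcv ha h1 (a := 1 - t * K) (b := t * K) (by linarith) (by positivity) (by ring)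
    convert h2 using 1
    have : (t * K) • K⁻¹ • d = t • d := by
      rw [smul_smul, mul_assoc, mul_inv_cancel₀ hK0.ne', mul_one]
    rw [smul_add (t * K), this]
    module
  -- Here `ν` pairs positively with the displacement: `⟪ν, d⟫ ≥ -‖d‖ > -K * r`, while `-K * ⟪ν, w -
  -- a⟫ ≥ K * r`.
  have hout : a + t • (d + (-K) • (w - a)) ∉ C := by
    intro hmem
    have h1 := h _ hmem
    have h2 := inner_le_neg_of_closedBall_subset hr.le hw hν h
    have h3 : -‖d‖ ≤ ⟪ν, d⟫ := by
      have := abs_real_inner_le_norm ν d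
      rw [hν, one_mul] at this
      exact (abs_le.1 this).1
    rw [add_sub_cancel_left, inner_smul_right, inner_add_right, inner_smul_right] at h1
    have h4 := nonpos_of_mul_nonpos_right h1 ht
    nlinarith
  obtain ⟨_, ⟨s, hs, rfl⟩, hf⟩ := inter_frontier_nonempty hpre
    ⟨_, ⟨K, ⟨by linarith, le_rfl⟩, rfl⟩, hin⟩ ⟨_, ⟨-K, ⟨le_rfl, by linarith⟩, rfl⟩, hout⟩
  exact ⟨s, hs, hf⟩

/-- At a point where the boundary of a convex set with interior points is a `C¹` manifold, the outer
unit normal is unique. -/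
theorem unit_normal_unique {C : Set E} (hcl : IsClosed C) (hcv : Convex ℝ C)
    [FiniteDimensional ℝ E] (hC : IsLocallyC1Manifold (frontier C)) {a w ν ν' : E} {r : ℝ}
    (hr : 0 < r) (ha : a ∈ frontier C) (hw : Metric.closedBall w r ⊆ C)
    (hν : ‖ν‖ = 1) (h : ∀ u ∈ C, ⟪ν, u - a⟫ ≤ 0)
    (hν' : ‖ν'‖ = 1) (h' : ∀ u ∈ C, ⟪ν', u - a⟫ ≤ 0) : ν = ν' := by
  have haC : a ∈ C := hcl.frontier_subset ha
  obtain ⟨φ, L, has, hφ, hψ, hL⟩ := hC a ha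
  have hφa : HasFDerivAt φ (fderiv ℝ φ a) a :=
    ((hφ.contDiffAt (φ.open_source.mem_nhds has)).differentiableAt (by simp)).hasFDerivAt
  have hbt : φ a ∈ φ.target := φ.map_source has
  have hψb : HasFDerivAt φ.symm (fderiv ℝ φ.symm (φ a)) (φ a) :=
    ((hψ.contDiffAt (φ.open_target.mem_nhds hbt)).differentiableAt (by simp)).hasFDerivAt
  have hinv : ∀ τ, fderiv ℝ φ.symm (φ a) (fderiv ℝ φ a τ) = τ := by
    have h1 := hψb.comp a hφa
    have h2 : HasFDerivAt (φ.symm ∘ φ) (ContinuousLinearMap.id ℝ E) a :=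
      (hasFDerivAt_id a).congr_of_eventuallyEq
        (Filter.eventually_of_mem (φ.open_source.mem_nhds has) fun y hy => φ.left_inv hy)
    intro τ
    simpa using congrArg (fun T : E →L[ℝ] E => T τ) (h1.unique h2)
  have hφaL : φ a ∈ L := (hL a has).1 ha
  -- outer normals are orthogonal to tangent vectors
  have horth : ∀ μ : E, (∀ u ∈ C, ⟪μ, u - a⟫ ≤ 0) → ∀ τ, fderiv ℝ φ a τ ∈ L → ⟪μ, τ⟫ = 0 := by
    intro μ hμ τ hτ
    have hline : HasDerivAt (fun t : ℝ => φ a + t • fderiv ℝ φ a τ) (fderiv ℝ φ a τ) 0 := by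
      simpa using ((hasDerivAt_id (0 : ℝ)).smul_const (fderiv ℝ φ a τ)).const_add (φ a)
    have hcurve : HasDerivAt (fun t : ℝ => φ.symm (φ a + t • fderiv ℝ φ a τ)) τ 0 := by
      have := HasFDerivAt.comp_hasDerivAt_of_eq (0 : ℝ) hψb hline (by simp)
      rwa [hinv] at this
    have hg := (innerSL ℝ μ).hasFDerivAt.comp_hasDerivAt (0 : ℝ) hcurve
    -- The curve stays in the frontier, hence in `C`, where `⟪μ, ·⟫` is maximal at `a`.
    refine IsLocalMax.hasDerivAt_eq_zero (f := fun t : ℝ => ⟪μ, φ.symm (φ a + t • fderiv ℝ φ a τ)⟫)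
      (a := 0) ?_ hg
    have hnear : ∀ᶠ t : ℝ in 𝓝 0, φ a + t • fderiv ℝ φ a τ ∈ φ.target :=
      hline.continuousAt.eventually_mem (by simpa using φ.open_target.mem_nhds hbt)
    filter_upwards [hnear] with t ht
    have hmem : φ.symm (φ a + t • fderiv ℝ φ a τ) ∈ frontier C := by
      rw [hL _ (φ.map_target ht), φ.right_inv ht]
      exact L.add_mem hφaL (L.smul_mem _ hτ)
    have := hμ _ (hcl.frontier_subset hmem)
    rw [inner_sub_right] at this
    simpa [φ.left_inv has] using this
  -- tangent vectors together with `w - a` span everything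
  have hspan : ∀ d : E, ∃ σ : ℝ, fderiv ℝ φ a (d + σ • (w - a)) ∈ L := by
    intro d
    obtain ⟨K, hK⟩ : ∃ K : ℝ, ‖d‖ < K * r := ⟨(‖d‖ + 1) / r, by
      rw [div_mul_cancel₀ _ hr.ne']; linarith⟩
    have hK0 : 0 < K := pos_of_mul_pos_left ((norm_nonneg d).trans_lt hK) hr.le
    have hKn : ∀ k : ℕ, 0 < K + k := fun k => by positivity
    have hex : ∀ k : ℕ, ∃ s ∈ Set.Icc (-K) K,
        a + (K + k)⁻¹ • (d + s • (w - a)) ∈ frontier C := fun k =>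
      exists_mem_frontier_add_smul hcv hr haC hw hν h hK (inv_pos.2 (hKn k)) (by
        rw [inv_mul_le_iff₀ (hKn k)]; simp)
    choose s hs hsf using hex
    obtain ⟨σ, -, θ, hθ, hσ⟩ := isCompact_Icc.tendsto_subseq hs
    refine ⟨σ, ?_⟩
    have hdir : Tendsto (fun k => d + s (θ k) • (w - a)) atTop (𝓝 (d + σ • (w - a))) :=
      (hσ.smul_const _).const_add d
    have hscale : Tendsto (fun k => K + (θ k : ℝ)) atTop atTop :=
      tendsto_atTop_add_const_left _ _ (tendsto_natCast_atTop_atTop.comp hθ.tendsto_atTop)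
    have hstep : Tendsto (fun k => (K + (θ k : ℝ))⁻¹ • (d + s (θ k) • (w - a))) atTop (𝓝 0) := by
      simpa using (tendsto_inv_atTop_zero.comp hscale).smul hdir
    -- Chart differences between nearby frontier points and `a`, rescaled, lie in `L` and converge
    -- to the derivative along `d + σ • (w - a)`.
    have hlim := hφa.hasFDerivWithinAt (s := Set.univ).lim (c := fun k => K + (θ k : ℝ)) hstep
      (Eventually.of_forall fun _ => Set.mem_univ _)
      (hdir.congr fun k => (smul_inv_smul₀ (hKn _).ne' _).symm)
    refine L.closed_of_finiteDimensional.mem_of_tendsto hlim ?_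
    have hpt : Tendsto (fun k => a + (K + (θ k : ℝ))⁻¹ • (d + s (θ k) • (w - a))) atTop (𝓝 a) := by
      simpa using hstep.const_add a
    filter_upwards [hpt.eventually_mem (φ.open_source.mem_nhds has)] with k hk
    exact L.smul_mem _ (L.sub_mem ((hL _ hk).1 (hsf _)) hφaL)
  have hc : ⟪ν, w - a⟫ < 0 := by
    linarith [inner_le_neg_of_closedBall_subset hr.le hw hν h]
  have hc' : ⟪ν', w - a⟫ < 0 := by
    linarith [inner_le_neg_of_closedBall_subset hr.le hw hν' h']
  -- Both normals vanish on tangent vectors, so each is determined by its value on `w - a`.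
  have hprop : ⟪ν', w - a⟫ • ν = ⟪ν, w - a⟫ • ν' := by
    refine ext_inner_right ℝ fun d => ?_
    obtain ⟨σ, hσ⟩ := hspan d
    have e := horth ν h _ hσ
    have e' := horth ν' h' _ hσ
    rw [inner_add_right, inner_smul_right] at e e'
    rw [real_inner_smul_left, real_inner_smul_left]
    linear_combination ⟪ν', w - a⟫ * e - ⟪ν, w - a⟫ * e'
  have hnorm := congrArg norm hprop
  rw [norm_smul, norm_smul, hν, hν', Real.norm_eq_abs, Real.norm_eq_abs, abs_of_neg hc,
    abs_of_neg hc', mul_one, mul_one] at hnorm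
  rw [neg_injective hnorm] at hprop
  exact smul_right_injective E hc.ne hprop

/-- Along a sequence of points outside `C` that converges to a boundary point where the boundary is
smooth, the unit normals converge to the outer unit normal. -/
theorem exists_tendsto_unitNormal [FiniteDimensional ℝ E] {C : Set E} (hcl : IsClosed C)
    (hcv : Convex ℝ C) (hC : IsLocallyC1Manifold (frontier C)) {a w : E} {r : ℝ} (hr : 0 < r)
    (ha : a ∈ frontier C) (hw : Metric.closedBall w r ⊆ C) {x : ℕ → E} (hx : Tendsto x atTop (𝓝 a))
    (hxC : ∀ᶠ k in atTop, x k ∉ C) :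
    ∃ ν : E, ‖ν‖ = 1 ∧ (∀ u ∈ C, ⟪ν, u - a⟫ ≤ 0) ∧
      Tendsto (fun k => unitNormal C (x k)) atTop (𝓝 ν) := by
  have haC : a ∈ C := hcl.frontier_subset ha
  have hsphere : ∀ᶠ k in atTop, unitNormal C (x k) ∈ Metric.sphere (0 : E) 1 :=
    hxC.mono fun k hk => by simpa using norm_unitNormal ⟨a, haC⟩ hcl hcv hk
  have hp := tendsto_proj hcl hcv haC hx
  have hlim : ∀ (θ : ℕ → ℕ) (ν : E), Tendsto θ atTop atTop →
      Tendsto (fun k => unitNormal C (x (θ k))) atTop (𝓝 ν) →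
      ‖ν‖ = 1 ∧ ∀ u ∈ C, ⟪ν, u - a⟫ ≤ 0 := by
    intro θ ν hθ hν
    refine ⟨by simpa using Metric.isClosed_sphere.mem_of_tendsto hν (hθ.eventually hsphere), ?_⟩
    intro u hu
    refine le_of_tendsto (hν.inner ((hp.comp hθ).const_sub u)) (Eventually.of_forall fun k => ?_)
    exact inner_unitNormal_nonpos (subset_supportHalfSpace hcl hcv _ hu)
  obtain ⟨ν, -, θ, hθ, hν⟩ :=
    (isCompact_sphere (0 : E) 1).tendsto_subseq' hsphere.frequently
  obtain ⟨h1, h2⟩ := hlim θ ν hθ.tendsto_atTop hν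
  -- Every cluster point on the compact sphere is an outer unit normal at `a`, hence equals `ν`.
  refine ⟨ν, h1, h2, tendsto_of_subseq_tendsto fun ns hns => ?_⟩
  obtain ⟨ν', -, θ', hθ', hν'⟩ :=
    (isCompact_sphere (0 : E) 1).tendsto_subseq' (hns.eventually hsphere).frequently
  have h3 := hlim (ns ∘ θ') ν' (hns.comp hθ'.tendsto_atTop) hν'
  rw [← unit_normal_unique hcl hcv hC hr ha hw h1 h2 h3.1 h3.2] at hν'
  exact ⟨θ', hν'⟩

end SmoothBoundary

/-! ### Convergence of the method and its rate. -/

section ThreePM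

variable {E : Type*} [NormedAddCommGroup E] [InnerProductSpace ℝ E] {ι : Type*} {U : ι → Set E}

theorem isClosed_threePMPolyhedron (U : ι → Set E) (x : E) : IsClosed (threePMPolyhedron U x) :=
  isClosed_iInter fun i => isClosed_supportHalfSpace (U i) x

theorem convex_threePMPolyhedron (U : ι → Set E) (x : E) : Convex ℝ (threePMPolyhedron U x) :=
  convex_iInter fun i => convex_supportHalfSpace (U i) x

theorem subset_threePMPolyhedron [CompleteSpace E] (hcl : ∀ i, IsClosed (U i))
    (hcv : ∀ i, Convex ℝ (U i)) (x : E) : ⋂ i, U i ⊆ threePMPolyhedron U x :=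
  Set.iInter_mono fun i => subset_supportHalfSpace (hcl i) (hcv i) x

variable [CompleteSpace E]

theorem isProj_threePM_succ (hcl : ∀ i, IsClosed (U i)) (hcv : ∀ i, Convex ℝ (U i))
    (hne : (⋂ i, U i).Nonempty) (x₁ : E) (k : ℕ) :
    IsProj (threePMPolyhedron U (threePM U x₁ k)) (threePM U x₁ k) (threePM U x₁ (k + 1)) :=
  isProj_proj (hne.mono (subset_threePMPolyhedron hcl hcv _)) (isClosed_threePMPolyhedron _ _)
    (convex_threePMPolyhedron _ _) _

theorem threePM_succ_inner_nonpos (hcl : ∀ i, IsClosed (U i)) (hcv : ∀ i, Convex ℝ (U i))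
    (hne : (⋂ i, U i).Nonempty) (x₁ : E) (k : ℕ) {z : E}
    (hz : z ∈ threePMPolyhedron U (threePM U x₁ k)) :
    ⟪threePM U x₁ k - threePM U x₁ (k + 1), z - threePM U x₁ (k + 1)⟫ ≤ 0 :=
  (isProj_threePM_succ hcl hcv hne x₁ k).inner_le_zero (convex_threePMPolyhedron _ _) hz

/-- Fejér monotonicity, with the decrease made explicit. -/
theorem norm_threePM_succ_sub_sq_le (hcl : ∀ i, IsClosed (U i)) (hcv : ∀ i, Convex ℝ (U i))
    (x₁ : E) (k : ℕ) {z : E} (hz : z ∈ ⋂ i, U i) :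
    ‖threePM U x₁ (k + 1) - z‖ ^ 2 ≤
      ‖threePM U x₁ k - z‖ ^ 2 - ‖threePM U x₁ k - threePM U x₁ (k + 1)‖ ^ 2 := by
  have h := threePM_succ_inner_nonpos hcl hcv ⟨z, hz⟩ x₁ k (subset_threePMPolyhedron hcl hcv _ hz)
  set x := threePM U x₁ k
  set p := threePM U x₁ (k + 1)
  have h1 : ‖x - z‖ ^ 2 = ‖x - p‖ ^ 2 - 2 * ⟪x - p, z - p⟫ + ‖p - z‖ ^ 2 := by
    rw [show x - z = (x - p) - (z - p) by abel, norm_sub_sq_real, norm_sub_rev z p]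
  linarith

theorem antitone_norm_threePM_sub (hcl : ∀ i, IsClosed (U i)) (hcv : ∀ i, Convex ℝ (U i))
    (x₁ : E) {z : E} (hz : z ∈ ⋂ i, U i) : Antitone fun k => ‖threePM U x₁ k - z‖ :=
  antitone_nat_of_succ_le fun k => le_of_sq_le_sq
    (by nlinarith [norm_threePM_succ_sub_sq_le hcl hcv x₁ k hz,
      sq_nonneg ‖threePM U x₁ k - threePM U x₁ (k + 1)‖]) (norm_nonneg _)

theorem tendsto_threePM_sub_succ (hcl : ∀ i, IsClosed (U i)) (hcv : ∀ i, Convex ℝ (U i))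
    (hne : (⋂ i, U i).Nonempty) (x₁ : E) :
    Tendsto (fun k => ‖threePM U x₁ k - threePM U x₁ (k + 1)‖) atTop (𝓝 0) := by
  obtain ⟨z, hz⟩ := hne
  have hlim := tendsto_atTop_ciInf (antitone_norm_threePM_sub hcl hcv x₁ hz)
    ⟨0, by rintro _ ⟨k, rfl⟩; exact norm_nonneg _⟩
  have hdiff := (hlim.pow 2).sub ((hlim.comp (tendsto_add_atTop_nat 1)).pow 2)
  rw [sub_self] at hdiff
  have hsq := squeeze_zero (fun k => sq_nonneg ‖threePM U x₁ k - threePM U x₁ (k + 1)‖)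
    (fun k => by
      have := norm_threePM_succ_sub_sq_le hcl hcv x₁ k hz
      simp only [Function.comp_apply]
      linarith) hdiff
  simpa using hsq.sqrt

theorem exists_tendsto_threePM [FiniteDimensional ℝ E] (hcl : ∀ i, IsClosed (U i))
    (hcv : ∀ i, Convex ℝ (U i)) (hne : (⋂ i, U i).Nonempty) (x₁ : E) :
    ∃ a ∈ ⋂ i, U i, Tendsto (threePM U x₁) atTop (𝓝 a) := by
  obtain ⟨z, hz⟩ := id hne
  have hbdd : ∀ k, threePM U x₁ k ∈ Metric.closedBall z ‖x₁ - z‖ := fun k =>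
    mem_closedBall_iff_norm.2 (antitone_norm_threePM_sub hcl hcv x₁ hz (Nat.zero_le k))
  obtain ⟨a, -, θ, hθ, ha⟩ := (isCompact_closedBall z ‖x₁ - z‖).tendsto_subseq hbdd
  have haU : a ∈ ⋂ i, U i := by
    refine Set.mem_iInter.2 fun i => ?_
    have hres : Tendsto (fun k => ‖threePM U x₁ k - proj (U i) (threePM U x₁ k)‖) atTop (𝓝 0) :=
      squeeze_zero (fun _ => norm_nonneg _)
        (fun k => (norm_sub_le_of_inner_nonpos
          (Set.mem_iInter.1 (isProj_threePM_succ hcl hcv hne x₁ k).1 i)).2)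
        (tendsto_threePM_sub_succ hcl hcv hne x₁)
    have hproj : Tendsto (fun k => proj (U i) (threePM U x₁ (θ k))) atTop (𝓝 a) := by
      simpa using ha.sub (tendsto_zero_iff_norm_tendsto_zero.2 (hres.comp hθ.tendsto_atTop))
    exact (hcl i).mem_of_tendsto hproj (Eventually.of_forall fun k =>
      (isProj_proj ⟨z, Set.mem_iInter.1 hz i⟩ (hcl i) (hcv i) _).1)
  refine ⟨a, haU, tendsto_iff_norm_sub_tendsto_zero.2 ?_⟩
  -- Distances to `a` decrease because `a` is in the intersection, so a subsequence decides.
  exact (tendsto_iff_tendsto_subseq_of_antitone (antitone_norm_threePM_sub hcl hcv x₁ haU)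
    hθ.tendsto_atTop).2 (tendsto_iff_norm_sub_tendsto_zero.1 ha)

/-- If from step `k + 1` on the vector `y = x_{k+1} - a` makes at most the inner product `η` with all
unit normals, while a fixed inward vector `v` makes at most `-δ`, then `‖y‖ ≤ (η / δ) ‖v‖`. -/
theorem norm_threePM_sub_le (hcl : ∀ i, IsClosed (U i)) (hcv : ∀ i, Convex ℝ (U i))
    (hne : (⋂ i, U i).Nonempty) {x₁ a v : E} (ha : Tendsto (threePM U x₁) atTop (𝓝 a)) {k : ℕ}
    {η δ : ℝ} (hη : 0 ≤ η) (hδ : 0 < δ)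
    (h : ∀ j ≥ k, ∀ i, threePM U x₁ j ∈ U i ∨
      (⟪unitNormal (U i) (threePM U x₁ j), threePM U x₁ k - a⟫ ≤ η ∧
        ⟪unitNormal (U i) (threePM U x₁ j), v⟫ ≤ -δ)) :
    ‖threePM U x₁ k - a‖ ≤ η / δ * ‖v‖ := by
  set x := threePM U x₁ with hx
  set y := x k - a with hy
  set t := y + (η / δ) • v with ht
  have hstep : ∀ j ≥ k, ⟪x j - x (j + 1), t⟫ ≤ 0 := by
    intro j hj
    -- Translating by `t` preserves every half-space of step `j`; testing the projection inequality
    -- at this point gives the claim.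
    have hmem : x (j + 1) + t ∈ threePMPolyhedron U (x j) := by
      refine Set.mem_iInter.2 fun i => add_mem_supportHalfSpace
        (Set.mem_iInter.1 (isProj_threePM_succ hcl hcv hne x₁ j).1 i) ?_
      rcases h j hj i with hU | ⟨h1, h2⟩
      · simp [unitNormal, proj_eq_self (hcl i) (hcv i) hU]
      · rw [ht, inner_add_right, inner_smul_right]
        have h3 := mul_le_mul_of_nonneg_left h2 (div_nonneg hη hδ.le)
        have h4 : η / δ * -δ = -η := by field_simp
        linarith
    have := threePM_succ_inner_nonpos hcl hcv hne x₁ j hmem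
    rwa [← hx, add_sub_cancel_left] at this
  have hsum : ∀ j ≥ k, ⟪x k - x j, t⟫ ≤ 0 := by
    intro j hj
    induction j, hj using Nat.le_induction with
    | base => simp
    | succ j hj ih =>
      rw [← sub_add_sub_cancel (x k) (x j), inner_add_left]
      linarith [hstep j hj]
  have hyt : ⟪y, t⟫ ≤ 0 :=
    le_of_tendsto ((ha.const_sub (x k)).inner tendsto_const_nhds)
      (eventually_atTop.2 ⟨k, hsum⟩)
  rw [ht, inner_add_right, inner_smul_right, real_inner_self_eq_norm_sq] at hyt
  have hyv := (abs_le.1 (abs_real_inner_le_norm y v)).1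
  have hq : 0 ≤ η / δ := div_nonneg hη hδ.le
  rcases (norm_nonneg y).eq_or_lt with h0 | h0
  · rw [← h0]; positivity
  · refine le_of_mul_le_mul_left ?_ h0
    nlinarith [mul_le_mul_of_nonneg_left hyv hq]

theorem threePM_isLittleO [FiniteDimensional ℝ E] [Finite ι] (hcl : ∀ i, IsClosed (U i))
    (hcv : ∀ i, Convex ℝ (U i)) (hint : (interior (⋂ i, U i)).Nonempty)
    (hman : ∀ i, IsLocallyC1Manifold (frontier (U i))) {x₁ a : E} (haU : a ∈ ⋂ i, U i)
    (ha : Tendsto (threePM U x₁) atTop (𝓝 a))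
    (hout : ∀ᶠ k in atTop, ∀ i, a ∉ interior (U i) → threePM U x₁ k ∉ U i) :
    (fun k => threePM U x₁ (k + 1) - a) =o[atTop] fun k => threePM U x₁ k - a := by
  have hne : (⋂ i, U i).Nonempty := ⟨a, haU⟩
  obtain ⟨w, hw⟩ := hint
  obtain ⟨r, hr, hball⟩ := Metric.nhds_basis_closedBall.mem_iff.1 (mem_interior_iff_mem_nhds.1 hw)
  have hwi : ∀ i, Metric.closedBall w r ⊆ U i := fun i => hball.trans (Set.iInter_subset _ i)
  have hai : ∀ i, a ∈ U i := Set.mem_iInter.1 haU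
  set v := w - a with hv
  -- eventual behaviour of the normals of a single set
  have key : ∀ i, ∀ ε > 0, ∀ᶠ k in atTop, ∀ j > k, threePM U x₁ j ∈ U i ∨
      (⟪unitNormal (U i) (threePM U x₁ j), threePM U x₁ (k + 1) - a⟫ ≤
          3 * ε * ‖threePM U x₁ k - a‖ ∧
        ⟪unitNormal (U i) (threePM U x₁ j), v⟫ ≤ -(r / 2)) := by
    intro i ε hε
    by_cases hi : a ∈ interior (U i)
    · obtain ⟨N, hN⟩ := eventually_atTop.1
        (ha.eventually_mem (mem_interior_iff_mem_nhds.1 hi))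
      exact eventually_atTop.2 ⟨N, fun k hk j hj => Or.inl (hN j (by omega))⟩
    · obtain ⟨ν, hν, hνC, hlim⟩ := exists_tendsto_unitNormal (hcl i) (hcv i) (hman i) hr
        ((hcl i).frontier_eq ▸ ⟨hai i, hi⟩) (hwi i) ha (hout.mono fun k hk => hk i hi)
      -- The bound `-r` at the limit is relaxed to `-(r / 2)` so that it persists for nearby
      -- normals.
      have hνv : ⟪ν, v⟫ < -(r / 2) := by
        linarith [inner_le_neg_of_closedBall_subset hr.le (hwi i) hν hνC]
      have e1 := (hlim.inner (tendsto_const_nhds (x := v))).eventually_lt_const hνv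
      have e2 : ∀ᶠ k in atTop, ‖unitNormal (U i) (threePM U x₁ k) - ν‖ < ε := by
        simpa [dist_eq_norm] using hlim.eventually (Metric.ball_mem_nhds ν hε)
      obtain ⟨N, hN⟩ := eventually_atTop.1 (e1.and e2)
      refine eventually_atTop.2 ⟨N, fun k hk j hj => Or.inr ⟨?_, (hN j (by omega)).1.le⟩⟩
      have hmono := antitone_norm_threePM_sub hcl hcv x₁ haU (Nat.le_succ k)
      have hp := norm_proj_sub_le (hcl i) (hcv i) (threePM U x₁ k) (hai i)
      have hpC := (isProj_proj ⟨a, hai i⟩ (hcl i) (hcv i) (threePM U x₁ k)).1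
      have hS := inner_unitNormal_nonpos
        (Set.mem_iInter.1 (isProj_threePM_succ hcl hcv hne x₁ k).1 i)
      have hj2 := (hN j (by omega)).2.le
      have hk2 := (hN k hk).2.le
      simp only [Nat.succ_eq_add_one] at hmono
      set y := threePM U x₁ (k + 1) - a
      set p := proj (U i) (threePM U x₁ k)
      set νj := unitNormal (U i) (threePM U x₁ j)
      set νk := unitNormal (U i) (threePM U x₁ k)
      set D := ‖threePM U x₁ k - a‖
      -- Replace `νj` by `ν`, then by `νk`, and split `y` at `p`. The part beyond `p` is nonpositive
      -- by the half-space at step `k`; on `p - a` return to `ν`, which is nonpositive on `C - a`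
      -- for `C = U i`. Each of the three exchanges costs `ε * D`.
      have b1 : ⟪νj - ν, y⟫ ≤ ε * D := (real_inner_le_norm _ _).trans (by gcongr)
      have b2 : ⟪ν - νk, y⟫ ≤ ε * D := (real_inner_le_norm _ _).trans (by
        rw [norm_sub_rev]; gcongr)
      have b3 : ⟪νk - ν, p - a⟫ ≤ ε * D := (real_inner_le_norm _ _).trans (by gcongr)
      have b4 := hνC p hpC
      have b5 : y = (threePM U x₁ (k + 1) - p) + (p - a) := by simp [y]
      have b6 : ⟪νk, y⟫ = ⟪νk, threePM U x₁ (k + 1) - p⟫ + ⟪νk, p - a⟫ := by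
        rw [b5, inner_add_right]
      rw [inner_sub_left] at b1 b2 b3
      linarith
  refine isLittleO_iff.2 fun c hc => ?_
  -- Chosen so that `3ε / (r / 2) * ‖v‖ ≤ c`; the `+ 1` covers `v = 0`.
  have hε : 0 < c * r / (6 * (‖v‖ + 1)) := by positivity
  filter_upwards [eventually_all.2 fun i => key i _ hε] with k hk
  refine (norm_threePM_sub_le hcl hcv hne ha (by positivity) (half_pos hr)
    fun j hj i => hk i j hj).trans ?_
  have : 3 * (c * r / (6 * (‖v‖ + 1))) * ‖threePM U x₁ k - a‖ / (r / 2) * ‖v‖ =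
      c * ‖threePM U x₁ k - a‖ * (‖v‖ / (‖v‖ + 1)) := by
    field_simp
    ring
  rw [this]
  exact mul_le_of_le_one_right (by positivity)
    ((div_le_one (by positivity)).2 (by linarith))

end ThreePM

theorem theorem2p3 {n m : ℕ} (U : Fin m → Set (EuclideanSpace ℝ (Fin n)))
    (hclosed : ∀ i, IsClosed (U i)) (hconvex : ∀ i, Convex ℝ (U i))
    (hint : (interior (⋂ i, U i)).Nonempty)
    (hmanifold : ∀ i, IsLocallyC1Manifold (frontier (U i)))
    (x₁ : EuclideanSpace ℝ (Fin n)) :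
    ∃ xbar ∈ ⋂ i, U i, Tendsto (threePM U x₁) atTop (𝓝 xbar) ∧
      ((∀ᶠ k in atTop, threePM U x₁ k ∉ ⋃ i ∈ {i | xbar ∉ interior (U i)}, U i) →
        ConvergesSuperlinearly (threePM U x₁) xbar) := by
  obtain ⟨a, haU, ha⟩ := exists_tendsto_threePM hclosed hconvex (hint.mono interior_subset) x₁
  refine ⟨a, haU, ha, fun hout => ⟨ha, ?_⟩⟩
  refine threePM_isLittleO hclosed hconvex hint hmanifold haU ha (hout.mono fun k hk i hi hmem => ?_)
  exact hk (Set.mem_biUnion (show i ∈ {i | a ∉ interior (U i)} from hi) hmem)
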